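/- All rings are commutative with $1$. A ring is *semi-real* if $-1$ is not a sum of squares, and $\sum R^2$ denotes the set of sums of squares of a ring $R$. *Multivalued structures.* A multiring carries a multivalued sum, a product, a negation and constants $0,1$; a ring is regarded as a multiring with $a+b=\{a+b\}$. A morphism $f$ preserves the product, negation, $0$ and $1$, and satisfies $f(a)\in f(b)+f(c)$ whenever $a\in b+c$. An isomorphism is a bijection $f$ that preserves product, negation, $0$, $1$ and satisfies $a\in b+c \iff f(a)\in f(b)+f(c)$. Let $\mathbf 3=\{-1,0,1\}$ be the sign hyperfield: the usual product and negation, $0+x=x+0=\{x\}$, $1+1=\{1\}$, $(-1)+(-1)=\{-1\}$, $1+(-1)=(-1)+1=\{-1,0,1\}$. *$Q(A)$.* For a ring $A$ let $\mathrm{sper}(A)$ be the set of morphisms $\sigma\colon A\to\mathbf 3$, and for $a\in A$ let $\hat a\colon \mathrm{sper}(A)\to\mathbf 3$, $\hat a(\sigma)=\sigma(a)$. Then $Q(A)=\{\hat a : a\in A\}$, with $\hat a\,\hat b=\widehat{ab}$, $-\hat a=\widehat{-a}$, constants $\hat 0,\hat 1$, and $\hat a\in\hat b+\hat c$ iff there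 are $a',b',c'\in A$ with $\hat a'=\hat a$, $\hat b'=\hat b$, $\hat c'=\hat c$ and $a'=b'+c'$. *Marshall quotient.* For a ring $B$ and a multiplicative set $S\subseteq B$ (that is, $1\in S$ and $SS\subseteq S$), $B/_mS$ is the set of classes of the relation $a\sim b\iff as=bt$ for some $s,t\in S$, with the product, negation and constants induced from $B$, and $\overline a\in\overline b+\overline c$ iff there are $a'\sim a$, $b'\sim b$, $c'\sim c$ with $a'=b'+c'$. *$V(A)$.* For a ring $A$ and $p\in\mathrm{spec}(A)$ let $K_A(p)=\mathrm{Frac}(A/p)$. $V(A)$ is the ring, under pointwise operations, of all families $f=(f(p))_{p\in\mathrm{spec}(A)}$ with $f(p)\in K_A(p)$ such that every $p\in\mathrm{spec}(A)$ lies in a set $U$, clopen in the constructible topology of $\mathrm{spec}(A)$, for which there are $x,y\in A$ with $y\notin q$ and $f(q)=x/y$ in $K_A(q)$ for all $q\in U$. Let $v_A\colon A\to V(A)$, $v_A(a)(p)=a/1$. **Corollary.** Let $A$ be a semi-real ring, and assume that there are a ring $B$ and a multiplicative set $S\subseteq B$ with $Q(A)\cong B/_mS$. Then $V(A)$ is a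 semi-real von Neumann regular ring (for each $f\in V(A)$ there is $g\in V(A)$ with $f=f^2g$), and it represents $Q(A)$ canonically: $$Q(A)\;\cong\; V(A)/_m\bigl(1+\textstyle\sum V(A)^2\bigr)\qquad\text{and}\qquad Q(A)\;\cong\; Q(V(A)),$$ where the isomorphisms can be chosen to send $\hat a$ to the class of $v_A(a)$ and to $\widehat{v_A(a)}$, respectively, for every $a\in A$. -/

import Mathlib

universe u v

/-! ### The language of multirings: a multivalued sum, a product, a negation, `0` and `1` -/

/-- A multivalued sum. -/
class HyperAdd (M : Type u) where
  hadd : M → M → Set M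

/-- Every ring carries the single-valued sum `a + b = {a + b}`. -/
instance CommRing.instHyperAdd (A : Type u) [CommRing A] : HyperAdd A where
  hadd a b := {a + b}

/-- The multivalued sum of the sign hyperfield `3 = {-1, 0, 1}`. Its product, negation and constants
are those of `SignType`. -/
def SignType.hyperSum : SignType → SignType → Set SignType
  | .zero, x => {x}
  | x, .zero => {x}
  | .pos, .pos => {1}
  | .neg, .neg => {-1}
  | .pos, .neg => Set.univ
  | .neg, .pos => Set.univ

instance SignType.instHyperAdd : HyperAdd SignType where
  hadd := SignType.hyperSum

/-- Morphisms of multirings. -/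
structure MultiringHom (M : Type u) (N : Type v)
    [HyperAdd M] [Mul M] [Neg M] [Zero M] [One M]
    [HyperAdd N] [Mul N] [Neg N] [Zero N] [One N] where
  toFun : M → N
  map_hadd : ∀ a b c : M, a ∈ HyperAdd.hadd b c → toFun a ∈ HyperAdd.hadd (toFun b) (toFun c)
  map_mul : ∀ a b : M, toFun (a * b) = toFun a * toFun b
  map_zero : toFun 0 = 0
  map_one : toFun 1 = 1
  map_neg : ∀ a : M, toFun (-a) = -toFun a

/-- Isomorphisms of multirings: bijections that preserve and reflect the multivalued sum and
preserve the remaining operations. -/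
structure MultiringEquiv (M : Type u) (N : Type v)
    [HyperAdd M] [Mul M] [Neg M] [Zero M] [One M]
    [HyperAdd N] [Mul N] [Neg N] [Zero N] [One N] extends M ≃ N where
  map_hadd : ∀ a b c : M,
    a ∈ HyperAdd.hadd b c ↔ toFun a ∈ HyperAdd.hadd (toFun b) (toFun c)
  map_mul : ∀ a b : M, toFun (a * b) = toFun a * toFun b
  map_zero : toFun 0 = 0
  map_one : toFun 1 = 1
  map_neg : ∀ a : M, toFun (-a) = -toFun a

/-! ### The real spectrum and the real reduced multiring `Q(A)` of a ring -/

/-- The orders of `A`: the multiring morphisms from `A` to the sign hyperfield `3`. -/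
abbrev Sper (A : Type u) [CommRing A] : Type u := MultiringHom A SignType

theorem Sper.map_add_mem {A : Type u} [CommRing A] (σ : Sper A) (a b : A) :
    σ.toFun (a + b) ∈ SignType.hyperSum (σ.toFun a) (σ.toFun b) :=
  σ.map_hadd (a + b) a b rfl

/-- The function `â` on the real spectrum, `â(σ) = σ(a)`. -/
def signFun {A : Type u} [CommRing A] (a : A) : Sper A → SignType := fun σ => σ.toFun a

/-- `Q(A)`, the set of all functions `â` with `a ∈ A`. -/
def RealReduction (A : Type u) [CommRing A] : Type u :=
  {f : Sper A → SignType // ∃ a : A, signFun a = f}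

namespace RealReduction

variable {A : Type u} [CommRing A]

/-- The canonical projection `A → Q(A)`. -/
def mk (a : A) : RealReduction A := ⟨signFun a, a, rfl⟩

/-- `x ∈ y + z` if some representatives satisfy `a = b + c` in `A`. -/
instance : HyperAdd (RealReduction A) where
  hadd y z := {x | ∃ a b c : A, mk a = x ∧ mk b = y ∧ mk c = z ∧ a ∈ HyperAdd.hadd b c}

instance : Mul (RealReduction A) where
  mul x y := ⟨fun σ => x.1 σ * y.1 σ, by
    obtain ⟨a, ha⟩ := x.2
    obtain ⟨b, hb⟩ := y.2
    refine ⟨a * b, funext fun σ => ?_⟩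
    rw [← ha, ← hb]
    exact σ.map_mul a b⟩

instance : Neg (RealReduction A) where
  neg x := ⟨fun σ => -x.1 σ, by
    obtain ⟨a, ha⟩ := x.2
    refine ⟨-a, funext fun σ => ?_⟩
    rw [← ha]
    exact σ.map_neg a⟩

instance : Zero (RealReduction A) where
  zero := mk 0

instance : One (RealReduction A) where
  one := mk 1

end RealReduction

/-! ### Marshall quotients of rings -/

/-- Marshall equivalence: `a ∼ b` if `a * s = b * t` for some `s, t ∈ S`. -/
def marshallSetoid {B : Type u} [CommRing B] (S : Submonoid B) : Setoid B where
  r a b := ∃ s ∈ S, ∃ t ∈ S, a * s = b * t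
  iseqv :=
    { refl := fun a => ⟨1, S.one_mem, 1, S.one_mem, rfl⟩
      symm := fun ⟨s, hs, t, ht, h⟩ => ⟨t, ht, s, hs, h.symm⟩
      trans := fun {a b c} ⟨s, hs, t, ht, h⟩ ⟨s', hs', t', ht', h'⟩ =>
        ⟨s * s', S.mul_mem hs hs', t' * t, S.mul_mem ht' ht, by
          calc a * (s * s') = (a * s) * s' := by ring
            _ = (b * s') * t := by rw [h]; ring
            _ = c * (t' * t) := by rw [h']; ring⟩ }

/-- The Marshall quotient of `B` by the multiplicative set `S`. -/
def MarshallQuotient {B : Type u} [CommRing B] (S : Submonoid B) : Type u :=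
  Quotient (marshallSetoid S)

namespace MarshallQuotient

variable {B : Type u} [CommRing B] {S : Submonoid B}

/-- The canonical projection. -/
def mk (S : Submonoid B) (b : B) : MarshallQuotient S := Quotient.mk (marshallSetoid S) b

/-- `x ∈ y + z` if some representatives satisfy `a = b + c` in `B`. -/
instance : HyperAdd (MarshallQuotient S) where
  hadd y z := {x | ∃ a b c : B, mk S a = x ∧ mk S b = y ∧ mk S c = z ∧ a ∈ HyperAdd.hadd b c}

instance : Mul (MarshallQuotient S) where
  mul := Quotient.map₂ (· * ·) (by
    rintro a a' ⟨s, hs, s', hs', h⟩ b b' ⟨t, ht, t', ht', h'⟩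
    refine ⟨s * t, S.mul_mem hs ht, s' * t', S.mul_mem hs' ht', ?_⟩
    calc a * b * (s * t) = (a * s) * (b * t) := by ring
      _ = a' * b' * (s' * t') := by rw [h, h']; ring)

instance : Neg (MarshallQuotient S) where
  neg := Quotient.map (fun a => -a) (by
    rintro a a' ⟨s, hs, s', hs', h⟩
    exact ⟨s, hs, s', hs', by simp only [neg_mul, h]⟩)

instance : Zero (MarshallQuotient S) where
  zero := mk S 0

instance : One (MarshallQuotient S) where
  one := mk S 1

end MarshallQuotient

/-- The multiplicative set `1 + ∑ R²`. -/
def onePlusSumSq (R : Type u) [CommRing R] : Submonoid R where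
  carrier := {x | ∃ s : R, IsSumSq s ∧ x = 1 + s}
  one_mem' := ⟨0, IsSumSq.zero, by ring⟩
  mul_mem' := by
    rintro _ _ ⟨s, hs, rfl⟩ ⟨t, ht, rfl⟩
    exact ⟨s + t + s * t, (hs.add ht).add (hs.mul ht), by ring⟩

/-! ### The von Neumann regular hull `V(A)` of a ring -/

/-- A family `f(p)`, with `f(p)` in the residue field `Frac (A / p)`, is a constructible section if
every prime has a neighbourhood that is clopen in the constructible topology and on which `f` is a
fraction `x / y` whose denominator vanishes nowhere. -/
def IsConstructibleSection {A : Type u} [CommRing A]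
    (f : ∀ p : PrimeSpectrum A, p.asIdeal.ResidueField) : Prop :=
  ∀ p : PrimeSpectrum A, ∃ U : Set (PrimeSpectrum A),
    @IsClopen _ (constructibleTopology (PrimeSpectrum A)) U ∧ p ∈ U ∧
    ∃ x y : A, ∀ q ∈ U, y ∉ q.asIdeal ∧
      f q = algebraMap A q.asIdeal.ResidueField x / algebraMap A q.asIdeal.ResidueField y

theorem isConstructibleSection_algebraMap {A : Type u} [CommRing A] (a : A) :
    IsConstructibleSection (fun p : PrimeSpectrum A => algebraMap A p.asIdeal.ResidueField a) := fun p =>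
  ⟨Set.univ, @isClopen_univ _ (constructibleTopology (PrimeSpectrum A)), trivial, a, 1,
    fun q _ => ⟨q.isPrime.one_notMem, by simp⟩⟩

/-- The ring `V(A)` of constructible sections, with pointwise operations. -/
def vonNeumannSubring (A : Type u) [CommRing A] :
    Subring (∀ p : PrimeSpectrum A, p.asIdeal.ResidueField) where
  carrier := {f | IsConstructibleSection f}
  zero_mem' := by
    have h := isConstructibleSection_algebraMap (0 : A)
    simp only [map_zero] at h
    exact h
  one_mem' := by
    have h := isConstructibleSection_algebraMap (1 : A)
    simp only [map_one] at h
    exact h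
  neg_mem' := by
    intro f hf p
    obtain ⟨U, hU, hp, x, y, h⟩ := hf p
    refine ⟨U, hU, hp, -x, y, fun q hq => ⟨(h q hq).1, ?_⟩⟩
    rw [Pi.neg_apply, (h q hq).2, map_neg, neg_div]
  mul_mem' := by
    intro f g hf hg p
    obtain ⟨U, hU, hp, x, y, h⟩ := hf p
    obtain ⟨U', hU', hp', x', y', h'⟩ := hg p
    refine ⟨U ∩ U', @IsClopen.inter _ (constructibleTopology (PrimeSpectrum A)) _ _ hU hU',
      ⟨hp, hp'⟩, x * x', y * y', fun q hq => ⟨fun hy => ?_, ?_⟩⟩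
    · exact (q.isPrime.mem_or_mem hy).elim (h q hq.1).1 (h' q hq.2).1
    · rw [Pi.mul_apply, (h q hq.1).2, (h' q hq.2).2, map_mul, map_mul, div_mul_div_comm]
  add_mem' := by
    intro f g hf hg p
    obtain ⟨U, hU, hp, x, y, h⟩ := hf p
    obtain ⟨U', hU', hp', x', y', h'⟩ := hg p
    refine ⟨U ∩ U', @IsClopen.inter _ (constructibleTopology (PrimeSpectrum A)) _ _ hU hU',
      ⟨hp, hp'⟩, x * y' + y * x', y * y', fun q hq => ⟨fun hy => ?_, ?_⟩⟩
    · exact (q.isPrime.mem_or_mem hy).elim (h q hq.1).1 (h' q hq.2).1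
    · have hy := mt Ideal.algebraMap_residueField_eq_zero.mp (h q hq.1).1
      have hy' := mt Ideal.algebraMap_residueField_eq_zero.mp (h' q hq.2).1
      rw [Pi.add_apply, (h q hq.1).2, (h' q hq.2).2, map_add, map_mul, map_mul, map_mul,
        div_add_div _ _ hy hy']

/-- The von Neumann regular hull `V(A)`. -/
abbrev VonNeumannHull (A : Type u) [CommRing A] : Type u := vonNeumannSubring A

/-- The natural map `v_A : A → V(A)`. -/
noncomputable def toVonNeumannHull {A : Type u} [CommRing A] (a : A) : VonNeumannHull A :=
  ⟨fun p => algebraMap A p.asIdeal.ResidueField a, isConstructibleSection_algebraMap a⟩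

/-- A commutative ring is von Neumann regular if every `a` is of the form `a² b`. -/
def IsVonNeumannRegular (R : Type u) [CommRing R] : Prop :=
  ∀ a : R, ∃ b : R, a = a ^ 2 * b

/-! The hypothesis on `Q(A)` is used only through `HasComplements`: for each `a` some element of `A`
has sign `1` where `a` vanishes on the real spectrum and `0` elsewhere. To get it, represent the
image of `â` by `b : B`. From `â³ = â` it follows that `b³s = bt` with `s, t ∈ S`, so `b²s - t`
annihilates `b` while its class lies in `â² - 1`; the negative of the corresponding element of
`Q(A)` is the indicator (`hasComplements_of_marshallQuotient`).

Restriction along `v_A` is a bijection from the orders of `V(A)` to those of `A`, because an order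
extends uniquely through the residue field at its support (`restrict_hull`, `hull_restrict`). An
element of `V(A)` is locally a fraction `x / y`, with the sign of `xy`. Compactness of the
constructible topology and the indicators glue these local signs into the sign of one element of
`A`, compatibly with a sum `g + h` (`exists_sign_eq`). Hence `Q(A) ≅ Q(V(A))`.

Finally, a von Neumann regular ring `R` satisfies `Q(R) ≅ R/ₘ(1 + ∑ R²)`: over fields this is
Artin's theorem, and idempotents glue the witnesses from the residue fields
(`IsVonNeumannRegular.exists_onePlusSumSq_mul_eq`). -/

theorem SignType.mem_hyperSum {s a b : SignType} :
    s ∈ SignType.hyperSum a b ↔ (a = 0 → s = b) ∧ (b = 0 → s = a) ∧ (a = b → s = a) := by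
  cases a <;> cases b <;> cases s <;> simp [SignType.hyperSum]

/-! ### Orders of a ring: pullback, signs and supports -/

namespace MultiringHom

/-- Composition of an order with a ring homomorphism. -/
def compRingHom {A : Type u} {R : Type v} [CommRing A] [CommRing R] (τ : Sper R) (φ : A →+* R) :
    Sper A where
  toFun a := τ.toFun (φ a)
  map_hadd a b c h := by
    obtain rfl : a = b + c := h
    rw [_root_.map_add]
    exact Sper.map_add_mem τ _ _
  map_mul a b := by rw [_root_.map_mul, τ.map_mul]
  map_zero := by rw [_root_.map_zero, τ.map_zero]
  map_one := by rw [_root_.map_one, τ.map_one]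
  map_neg a := by rw [_root_.map_neg, τ.map_neg]

end MultiringHom

namespace Sper

variable {A : Type u} [CommRing A]

@[ext]
theorem ext {σ τ : Sper A} (h : ∀ a, σ.toFun a = τ.toFun a) : σ = τ := by
  obtain ⟨f, _, _, _, _, _⟩ := σ
  obtain ⟨g, _, _, _, _, _⟩ := τ
  obtain rfl : f = g := funext h
  rfl

theorem add_of_eq_zero (σ : Sper A) (a : A) {b : A} (hb : σ.toFun b = 0) :
    σ.toFun (a + b) = σ.toFun a :=
  (SignType.mem_hyperSum.1 (σ.map_add_mem a b)).2.1 hb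

theorem zero_add_of_eq_zero (σ : Sper A) {a : A} (b : A) (ha : σ.toFun a = 0) :
    σ.toFun (a + b) = σ.toFun b :=
  (SignType.mem_hyperSum.1 (σ.map_add_mem a b)).1 ha

theorem congr_of_sub_eq_zero (σ : Sper A) {a b : A} (h : σ.toFun (a - b) = 0) :
    σ.toFun a = σ.toFun b := by
  simpa using σ.zero_add_of_eq_zero b h

theorem map_sq (σ : Sper A) (a : A) : σ.toFun (a ^ 2) = σ.toFun a ^ 2 := by
  rw [pow_two, σ.map_mul, pow_two]

theorem one_add_isSumSq (σ : Sper A) {s : A} (hs : IsSumSq s) : σ.toFun (1 + s) = 1 := by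
  have key : σ.toFun s = 0 ∨ σ.toFun s = 1 := by
    induction hs with
    | zero => exact Or.inl σ.map_zero
    | @sq_add a s _ ih =>
      have h := SignType.mem_hyperSum.1 (σ.map_add_mem (a * a) s)
      rw [σ.map_mul] at h
      revert h ih
      generalize σ.toFun a = x
      generalize σ.toFun s = y
      generalize σ.toFun (a * a + s) = z
      revert x y z
      decide
  have h := SignType.mem_hyperSum.1 (σ.map_add_mem 1 s)
  rw [σ.map_one] at h
  obtain h0 | h0 := key
  · exact h.2.1 h0
  · exact h.2.2 h0.symm

/-- The support of an order, as a point of the prime spectrum. -/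
def supp (σ : Sper A) : PrimeSpectrum A where
  asIdeal :=
    { carrier := {a | σ.toFun a = 0}
      zero_mem' := σ.map_zero
      add_mem' := fun {a b} ha hb => (σ.add_of_eq_zero a hb).trans ha
      smul_mem' := fun c a ha => by
        change σ.toFun (c * a) = 0
        rw [σ.map_mul, show σ.toFun a = 0 from ha, mul_zero] }
  isPrime :=
    { ne_top' := fun h => by
        have h1 : σ.toFun 1 = 0 := (Ideal.eq_top_iff_one _).1 h
        rw [σ.map_one] at h1
        exact absurd h1 (by decide)
      mem_or_mem' := fun {a b} hab => by
        have h : σ.toFun a * σ.toFun b = 0 := (σ.map_mul a b).symm.trans hab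
        exact mul_eq_zero.1 h }

theorem mem_supp {σ : Sper A} {a : A} : a ∈ σ.supp.asIdeal ↔ σ.toFun a = 0 := Iff.rfl

theorem isSemireal_of_sper (σ : Sper A) : IsSemireal A :=
  ⟨fun hs h => by
    have h1 := σ.one_add_isSumSq hs
    rw [h, σ.map_zero] at h1
    exact absurd h1 (by decide)⟩

/-- The order of a linearly ordered field. -/
def ofLinearOrder (K : Type u) [Field K] [LinearOrder K] [IsStrictOrderedRing K] : Sper K where
  toFun a := SignType.sign a
  map_hadd a b c h := by
    obtain rfl : a = b + c := h
    refine SignType.mem_hyperSum.2 ⟨fun h => ?_, fun h => ?_, fun h => ?_⟩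
    · rw [sign_eq_zero_iff] at h
      rw [h, zero_add]
    · rw [sign_eq_zero_iff] at h
      rw [h, add_zero]
    · obtain hb | hb | hb := lt_trichotomy b 0
      · rw [sign_neg hb] at h ⊢
        exact sign_neg (add_neg hb (sign_eq_neg_one_iff.1 h.symm))
      · rw [hb, sign_zero] at h ⊢
        rw [zero_add, ← h]
      · rw [sign_pos hb] at h ⊢
        exact sign_pos (add_pos hb (sign_eq_one_iff.1 h.symm))
  map_mul a b := sign_mul a b
  map_zero := sign_zero
  map_one := sign_one
  map_neg a := Left.sign_neg a

end Sper

/-! ### Preorderings and Artin's theorem for fields -/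

namespace RingPreordering

theorem exists_maximal_ge {R : Type u} [CommRing R] (T : RingPreordering R) :
    ∃ P : RingPreordering R, T ≤ P ∧ ∀ Q : RingPreordering R, P ≤ Q → Q ≤ P := by
  obtain ⟨P, hTP, hP⟩ := zorn_le_nonempty_Ici₀ T (fun c _ hc Q hQ => by
    have hmem : ∀ {x y : R}, (∃ P ∈ c, x ∈ P) → (∃ P ∈ c, y ∈ P) → ∃ P ∈ c, x ∈ P ∧ y ∈ P := by
      rintro x y ⟨P, hP, hx⟩ ⟨P', hP', hy⟩
      obtain h | h := hc.total hP hP'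
      · exact ⟨P', hP', h hx, hy⟩
      · exact ⟨P, hP, hx, h hy⟩
    exact ⟨RingPreordering.mk' {x | ∃ P ∈ c, x ∈ P}
      (fun hx hy => let ⟨P, hP, hx, hy⟩ := hmem hx hy; ⟨P, hP, add_mem hx hy⟩)
      (fun hx hy => let ⟨P, hP, hx, hy⟩ := hmem hx hy; ⟨P, hP, mul_mem hx hy⟩)
      (fun x => ⟨Q, hQ, Q.mul_self_mem x⟩)
      (fun ⟨P, _, h⟩ => P.neg_one_notMem h),
      fun P hP x hx => ⟨P, hP, hx⟩⟩) T le_rfl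
  exact ⟨P, hTP, fun Q hQ => hP hQ⟩

variable {K : Type u} [Field K]

/-- Adjoining `-x` to a preordering of a field that does not contain `x`. -/
def adjoinNeg (P : RingPreordering K) {x : K} (hx : x ∉ P) : RingPreordering K :=
  RingPreordering.mk' {z | ∃ p ∈ P, ∃ q ∈ P, z = p - x * q}
    (by
      rintro _ _ ⟨p, hp, q, hq, rfl⟩ ⟨p', hp', q', hq', rfl⟩
      exact ⟨p + p', add_mem hp hp', q + q', add_mem hq hq', by ring⟩)
    (by
      rintro _ _ ⟨p, hp, q, hq, rfl⟩ ⟨p', hp', q', hq', rfl⟩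
      exact ⟨p * p' + x * x * (q * q'),
        add_mem (mul_mem hp hp') (mul_mem (P.mul_self_mem x) (mul_mem hq hq')),
        p * q' + q * p', add_mem (mul_mem hp hq') (mul_mem hq hp'), by ring⟩)
    (fun y => ⟨y * y, P.mul_self_mem y, 0, zero_mem P, by ring⟩)
    (by
      rintro ⟨p, hp, q, hq, h⟩
      by_cases hq0 : q = 0
      · rw [hq0, mul_zero, sub_zero] at h
        exact P.neg_one_notMem (h ▸ hp)
      · refine hx ?_
        -- Solving `-1 = p - xq` for `x` puts `x` in `P`, as preorderings of fields are closed under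
        -- inverses.
        have hx' : x = (1 + p) * q⁻¹ := by
          field_simp
          linear_combination h
        rw [hx']
        exact mul_mem (add_mem (one_mem P) hp) (P.inv_mem hq))

theorem le_adjoinNeg (P : RingPreordering K) {x : K} (hx : x ∉ P) : P ≤ P.adjoinNeg hx :=
  fun p hp => ⟨p, hp, 0, zero_mem P, by ring⟩

theorem neg_mem_adjoinNeg (P : RingPreordering K) {x : K} (hx : x ∉ P) : -x ∈ P.adjoinNeg hx :=
  ⟨0, zero_mem P, 1, one_mem P, by ring⟩

/-- A maximal preordering is total: if it misses `x`, then adjoining `-x` keeps it proper and so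
adds nothing. -/
theorem exists_hasMemOrNegMem (T : RingPreordering K) :
    ∃ P : RingPreordering K, T ≤ P ∧ ∀ x, x ∈ P ∨ -x ∈ P := by
  obtain ⟨P, hT, hP⟩ := T.exists_maximal_ge
  refine ⟨P, hT, fun x => or_iff_not_imp_left.2 fun hx => ?_⟩
  exact hP _ (P.le_adjoinNeg hx) (P.neg_mem_adjoinNeg hx)

/-- A total preordering of a field is the nonnegative cone of a linear order, whose sign map is the
required order. -/
theorem exists_sper (T : RingPreordering K) : ∃ σ : Sper K, ∀ x ∈ T, x ≠ 0 → σ.toFun x = 1 := by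
  classical
  obtain ⟨P, hT, hP⟩ := T.exists_hasMemOrNegMem
  let C : RingCone K :=
    { P.toSubsemiring with
      eq_zero_of_mem_of_neg_mem' := fun {a} h h' => RingPreordering.eq_zero_of_mem_of_neg_mem h h' }
  have : HasMemOrNegMem C := ⟨hP⟩
  let _ : LinearOrder K := LinearOrder.mkOfAddGroupCone C
  have : IsOrderedRing K := IsOrderedRing.mkOfCone C
  have : IsStrictOrderedRing K := IsOrderedRing.toIsStrictOrderedRing K
  refine ⟨Sper.ofLinearOrder K, fun x hx h0 => sign_pos (lt_of_le_of_ne ?_ h0.symm)⟩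
  change x - 0 ∈ P
  rw [sub_zero]
  exact hT hx

end RingPreordering

/-- The preordering of sums of squares. -/
def RingPreordering.sumSq (R : Type u) [CommRing R] [IsSemireal R] : RingPreordering R :=
  RingPreordering.mk' {x | IsSumSq x} (fun hx hy => hx.add hy) (fun hx hy => hx.mul hy)
    (fun x => IsSumSq.mul_self x) (IsSemireal.not_isSumSq_neg_one R)

namespace Sper

variable {K : Type u} [Field K]

theorem nonempty_of_isSemireal [IsSemireal K] : Nonempty (Sper K) :=
  let ⟨σ, _⟩ := (RingPreordering.sumSq K).exists_sper
  ⟨σ⟩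

/-- Artin's theorem: in a semireal field every element that is positive at all orders is a sum of
squares. -/
theorem isSumSq_of_forall_pos [IsSemireal K] {x : K} (h : ∀ σ : Sper K, σ.toFun x = 1) :
    IsSumSq x := by
  by_contra hx
  have hx' : x ∉ RingPreordering.sumSq K := hx
  obtain ⟨σ, hσ⟩ := ((RingPreordering.sumSq K).adjoinNeg hx').exists_sper
  have h0 : x ≠ 0 := fun h0 => hx (h0 ▸ IsSumSq.zero)
  have h1 := hσ (-x) (RingPreordering.neg_mem_adjoinNeg _ hx') (neg_ne_zero.2 h0)
  rw [σ.map_neg, h σ] at h1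
  exact absurd h1 (by decide)

end Sper

/-- For nonzero `f` and `g` of equal sign everywhere, `fg` is a sum of squares by Artin's theorem.
Then so are `g/f` and `f/g`, and `f(1 + g/f) = f + g = g(1 + f/g)`. If `-1` is a sum of squares,
both factors can be taken to be `0`. -/
theorem exists_onePlusSumSq_mul_eq {K : Type u} [Field K] {f g : K}
    (h : ∀ σ : Sper K, σ.toFun f = σ.toFun g) :
    ∃ s t : K, IsSumSq s ∧ IsSumSq t ∧ f * (1 + s) = g * (1 + t) := by
  by_cases hK : IsSemireal K
  · obtain ⟨σ⟩ := Sper.nonempty_of_isSemireal (K := K)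
    have hz : ∀ x : K, σ.toFun x = 0 ↔ x = 0 := fun x => by
      refine ⟨fun hx => by_contra fun h0 => ?_, fun hx => hx ▸ σ.map_zero⟩
      have h1 := σ.map_mul x x⁻¹
      rw [mul_inv_cancel₀ h0, σ.map_one, hx, zero_mul] at h1
      exact absurd h1 (by decide)
    by_cases hf : f = 0
    · have hg : g = 0 := by rw [← hz, ← h, hz, hf]
      exact ⟨0, 0, IsSumSq.zero, IsSumSq.zero, by rw [hf, hg]⟩
    · have hg : g ≠ 0 := fun hg => hf (by rw [← hz, h, hz, hg])
      have hfg : IsSumSq (f * g) := by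
        refine Sper.isSumSq_of_forall_pos fun τ => ?_
        have h1 := τ.map_mul f f⁻¹
        rw [mul_inv_cancel₀ hf, τ.map_one] at h1
        rw [τ.map_mul, ← h]
        revert h1
        generalize τ.toFun f = a
        generalize τ.toFun f⁻¹ = b
        revert a b
        decide
      refine ⟨f * g * (f⁻¹ * f⁻¹), f * g * (g⁻¹ * g⁻¹), hfg.mul (IsSumSq.mul_self _),
        hfg.mul (IsSumSq.mul_self _), ?_⟩
      field_simp
      ring
  · rw [isSemireal_iff_not_isSumSq_neg_one, not_not] at hK
    exact ⟨-1, -1, hK, hK, by ring⟩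

theorem IsSumSq.exists_map_eq {R : Type u} {K : Type v} [CommRing R] [CommRing K] (φ : R →+* K)
    (hφ : Function.Surjective φ) {s : K} (hs : IsSumSq s) : ∃ r, IsSumSq r ∧ φ r = s := by
  induction hs with
  | zero => exact ⟨0, IsSumSq.zero, map_zero φ⟩
  | sq_add a _ ih =>
    obtain ⟨r, hr, rfl⟩ := ih
    obtain ⟨b, rfl⟩ := hφ a
    exact ⟨b * b + r, hr.sq_add b, by simp⟩

/-! ### Gluing over a von Neumann regular ring -/

namespace IsVonNeumannRegular

variable {R : Type u} [CommRing R]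

theorem exists_idempotent (hR : IsVonNeumannRegular R) (a : R) :
    ∃ e : R, e * e = e ∧ a * e = a ∧ ∃ b, e = a * b := by
  obtain ⟨b, hb⟩ := hR a
  exact ⟨a * b, by linear_combination (-b) * hb, by linear_combination -hb, b, rfl⟩

/-- The elements `e` such that `f` and `g` agree up to factors from `1 + ∑ R²` on the locus where
`e` does not vanish. -/
def marshallIdeal (hR : IsVonNeumannRegular R) (f g : R) : Ideal R where
  carrier := {e | ∃ s t, IsSumSq s ∧ IsSumSq t ∧ e * (f * (1 + s) - g * (1 + t)) = 0}
  zero_mem' := ⟨0, 0, IsSumSq.zero, IsSumSq.zero, by ring⟩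
  smul_mem' := by
    rintro c e ⟨s, t, hs, ht, h⟩
    exact ⟨s, t, hs, ht, by rw [smul_eq_mul, mul_assoc, h, mul_zero]⟩
  add_mem' := by
    rintro e e' ⟨s, t, hs, ht, h⟩ ⟨s', t', hs', ht', h'⟩
    -- Use the witnesses of `e` where `i = 1` and those of `e'` where `i = 0`. Since `i` and `1 - i`
    -- are squares, the mixtures are again sums of squares.
    obtain ⟨i, hi, hei, b, hb⟩ := hR.exists_idempotent e
    have hi' : IsSumSq i := hi ▸ IsSumSq.mul_self i
    have hj : IsSumSq (1 - i) := by
      have : (1 - i) * (1 - i) = 1 - i := by linear_combination hi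
      exact this ▸ IsSumSq.mul_self (1 - i)
    refine ⟨i * s + (1 - i) * s', i * t + (1 - i) * t', (hi'.mul hs).add (hj.mul hs'),
      (hi'.mul ht).add (hj.mul ht'), ?_⟩
    have h1 : i * (f * (1 + s) - g * (1 + t)) = 0 := by
      rw [hb]
      linear_combination b * h
    linear_combination h + (1 - i) * h' + e' * h1 - (f * s' - f * s - g * t' + g * t) * hei

/-- Were `marshallIdeal` inside a maximal ideal `m`, the field case in `R/m` would give witnesses
that lift to `R`. The idempotent `i` of their defect lies in `m`, whereas `1 - i` kills the defect
and so lies in `marshallIdeal`, forcing `1 ∈ m`. -/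
theorem exists_onePlusSumSq_mul_eq (hR : IsVonNeumannRegular R) {f g : R}
    (h : ∀ σ : Sper R, σ.toFun f = σ.toFun g) :
    ∃ s t : R, IsSumSq s ∧ IsSumSq t ∧ f * (1 + s) = g * (1 + t) := by
  suffices hI : hR.marshallIdeal f g = ⊤ by
    obtain ⟨s, t, hs, ht, hst⟩ := (Ideal.eq_top_iff_one _).1 hI
    exact ⟨s, t, hs, ht, sub_eq_zero.1 (by rwa [one_mul] at hst)⟩
  by_contra hI
  obtain ⟨m, hm, hIm⟩ := Ideal.exists_le_maximal _ hI
  let _ := Ideal.Quotient.field m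
  obtain ⟨s, t, hs, ht, hst⟩ := _root_.exists_onePlusSumSq_mul_eq
    (f := Ideal.Quotient.mk m f) (g := Ideal.Quotient.mk m g)
    fun σ => h (σ.compRingHom (Ideal.Quotient.mk m))
  obtain ⟨s, hs', rfl⟩ := hs.exists_map_eq _ Ideal.Quotient.mk_surjective
  obtain ⟨t, ht', rfl⟩ := ht.exists_map_eq _ Ideal.Quotient.mk_surjective
  obtain ⟨i, hi, hdi, b, hb⟩ := hR.exists_idempotent (f * (1 + s) - g * (1 + t))
  have hd : f * (1 + s) - g * (1 + t) ∈ m := by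
    rw [← Ideal.Quotient.mk_eq_mk_iff_sub_mem]
    simpa using hst
  have him : i ∈ m := hb ▸ m.mul_mem_right b hd
  have him' : 1 - i ∈ m := hIm ⟨s, t, hs', ht', by linear_combination -hdi⟩
  exact hm.ne_top ((Ideal.eq_top_iff_one _).2 (by simpa using m.add_mem him' him))

end IsVonNeumannRegular

open PrimeSpectrum TopologicalSpace Topology

/-! ### The constructible topology on the prime spectrum -/

section Constructible

variable {A : Type u} [CommRing A]

theorem isOpen_constructible_basicOpen (a : A) :
    IsOpen[constructibleTopology (PrimeSpectrum A)] {q : PrimeSpectrum A | a ∉ q.asIdeal} :=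
  (isCompact_basicOpen a).isOpen_constructibleTopology_of_isOpen (basicOpen a).isOpen

theorem isOpen_constructible_zeroLocus (a : A) :
    IsOpen[constructibleTopology (PrimeSpectrum A)] {q : PrimeSpectrum A | a ∈ q.asIdeal} := by
  have h : {q : PrimeSpectrum A | a ∈ q.asIdeal}ᶜ = basicOpen a := rfl
  refine IsCompact.isOpen_constructibleTopology_of_isClosed ?_ ?_
  · rw [h]
    exact isCompact_basicOpen a
  · rw [← isOpen_compl_iff, h]
    exact (basicOpen a).isOpen

theorem isClopen_constructible_basicOpen (a : A) :
    @IsClopen _ (constructibleTopology (PrimeSpectrum A))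
      {q : PrimeSpectrum A | a ∉ q.asIdeal} := by
  refine ⟨?_, isOpen_constructible_basicOpen a⟩
  rw [← @isOpen_compl_iff _ _ (constructibleTopology (PrimeSpectrum A))]
  simpa [Set.compl_def] using isOpen_constructible_zeroLocus a

theorem isClopen_constructible_zeroLocus (a : A) :
    @IsClopen _ (constructibleTopology (PrimeSpectrum A))
      {q : PrimeSpectrum A | a ∈ q.asIdeal} := by
  have h := @IsClopen.compl _ (constructibleTopology (PrimeSpectrum A)) _
    (isClopen_constructible_basicOpen a)
  simpa [Set.compl_def] using h

/-- The sets `D(a) ∩ V(s)` with `s` finite form a basis; one `a` suffices because `D(a) ∩ D(a') =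
D(aa')`. -/
theorem exists_basic_subset_of_isOpen_constructible {U : Set (PrimeSpectrum A)}
    (hU : IsOpen[constructibleTopology (PrimeSpectrum A)] U) {p : PrimeSpectrum A} (hp : p ∈ U) :
    ∃ a ∉ p.asIdeal, ∃ s : Finset A, (∀ b ∈ s, b ∈ p.asIdeal) ∧
      ∀ q : PrimeSpectrum A, a ∉ q.asIdeal → (∀ b ∈ s, b ∈ q.asIdeal) → q ∈ U := by
  classical
  have hU' : GenerateOpen (constructibleTopologySubbasis (PrimeSpectrum A)) U := hU
  induction hU' with
  | univ => exact ⟨1, p.isPrime.one_notMem, ∅, by simp, by simp⟩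
  | inter V W hV hW ihV ihW =>
    obtain ⟨a, ha, s, hs, h⟩ := ihV hV hp.1
    obtain ⟨a', ha', s', hs', h'⟩ := ihW hW hp.2
    refine ⟨a * a', fun h => (p.isPrime.mem_or_mem h).elim ha ha', s ∪ s', fun b hb => ?_,
      fun q hq hqs => ⟨h q (fun hq' => hq (q.asIdeal.mul_mem_right _ hq'))
        fun b hb => hqs b (Finset.mem_union_left _ hb),
        h' q (fun hq' => hq (q.asIdeal.mul_mem_left _ hq'))
        fun b hb => hqs b (Finset.mem_union_right _ hb)⟩⟩
    exact (Finset.mem_union.1 hb).elim (hs b) (hs' b)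
  | sUnion C hC ih =>
    obtain ⟨V, hV, hpV⟩ := hp
    obtain ⟨a, ha, s, hs, h⟩ := ih V hV (hC V hV) hpV
    exact ⟨a, ha, s, hs, fun q hq hqs => ⟨V, hV, h q hq hqs⟩⟩
  | basic V hV =>
    obtain ⟨hVo, -⟩ | ⟨hVc, hVk⟩ := hV
    · obtain ⟨_, ⟨a, rfl⟩, ha, haV⟩ :=
        isTopologicalBasis_basic_opens.exists_subset_of_mem_open hp hVo
      exact ⟨a, ha, ∅, by simp, fun q hq _ => haV hq⟩
    · obtain ⟨s, hs⟩ := (isCompact_isOpen_iff (s := Vᶜ)).1 ⟨hVk, hVc.isOpen_compl⟩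
      have hV' : V = zeroLocus (s : Set A) := compl_injective hs.symm
      subst hV'
      exact ⟨1, p.isPrime.one_notMem, s, fun b hb => hp hb, fun q _ hq b hb => hq b hb⟩

theorem isCompact_univ_constructible :
    @IsCompact _ (constructibleTopology (PrimeSpectrum A)) Set.univ := by
  have h : CompactSpace (WithConstructibleTopology (PrimeSpectrum A)) := inferInstance
  have h1 := @IsCompact.image _ _ _ (constructibleTopology (PrimeSpectrum A)) _ _ h.isCompact_univ
    (WithTopology.continuous_ofTopology _)
  rw [Set.image_univ] at h1
  convert h1
  symm
  exact Set.range_eq_univ.2 (WithTopology.ofTopology_surjective _)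

end Constructible

/-! ### Regularity of `V(A)` and its evaluation maps -/

namespace VonNeumannHull

variable {A : Type u} [CommRing A]

/-- With the convention `0⁻¹ = 0`, the pointwise inverse is a quasi-inverse. The zero set of the
numerator is clopen, so `0/1` can be used on it and `y/x` off it. -/
theorem isConstructibleSection_inv {f : ∀ p : PrimeSpectrum A, p.asIdeal.ResidueField}
    (hf : IsConstructibleSection f) : IsConstructibleSection fun p => (f p)⁻¹ := by
  intro p
  obtain ⟨U, hU, hp, x, y, h⟩ := hf p
  by_cases hx : x ∈ p.asIdeal
  · refine ⟨U ∩ {q | x ∈ q.asIdeal}, @IsClopen.inter _ (constructibleTopology _) _ _ hU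
      (isClopen_constructible_zeroLocus x), ⟨hp, hx⟩, 0, 1,
      fun q hq => ⟨q.isPrime.one_notMem, ?_⟩⟩
    change (f q)⁻¹ = _
    rw [(h q hq.1).2, Ideal.algebraMap_residueField_eq_zero.2 hq.2]
    simp
  · refine ⟨U ∩ {q | x ∉ q.asIdeal}, @IsClopen.inter _ (constructibleTopology _) _ _ hU
      (isClopen_constructible_basicOpen x), ⟨hp, hx⟩, y, x, fun q hq => ⟨hq.2, ?_⟩⟩
    change (f q)⁻¹ = _
    rw [(h q hq.1).2, inv_div]

theorem isVonNeumannRegular (A : Type u) [CommRing A] :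
    IsVonNeumannRegular (VonNeumannHull A) := by
  intro f
  refine ⟨⟨_, isConstructibleSection_inv f.2⟩, Subtype.ext (funext fun p => ?_)⟩
  change f.1 p = f.1 p ^ 2 * (f.1 p)⁻¹
  by_cases h : f.1 p = 0
  · simp [h]
  · field_simp

/-- Evaluation at a prime. -/
noncomputable def eval (p : PrimeSpectrum A) : VonNeumannHull A →+* p.asIdeal.ResidueField :=
  (Pi.evalRingHom _ p).comp (vonNeumannSubring A).subtype

/-- The natural map `v_A` as a ring homomorphism. -/
noncomputable def ofRing (A : Type u) [CommRing A] : A →+* VonNeumannHull A where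
  toFun := toVonNeumannHull
  map_one' := Subtype.ext (funext fun _ => map_one _)
  map_zero' := Subtype.ext (funext fun _ => map_zero _)
  map_mul' _ _ := Subtype.ext (funext fun _ => map_mul _ _ _)
  map_add' _ _ := Subtype.ext (funext fun _ => map_add _ _ _)

theorem eval_ofRing (p : PrimeSpectrum A) (a : A) :
    eval p (ofRing A a) = algebraMap A p.asIdeal.ResidueField a := rfl

theorem exists_isOpen_eval (f : VonNeumannHull A) (p : PrimeSpectrum A) :
    ∃ U, IsOpen[constructibleTopology (PrimeSpectrum A)] U ∧ p ∈ U ∧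
      ∃ x y : A, ∀ q ∈ U, y ∉ q.asIdeal ∧ eval q f =
        algebraMap A q.asIdeal.ResidueField x / algebraMap A q.asIdeal.ResidueField y :=
  let ⟨U, hU, h⟩ := f.2 p
  ⟨U, hU.2, h⟩

theorem ext_eval {f g : VonNeumannHull A} (h : ∀ p, eval p f = eval p g) : f = g :=
  Subtype.ext (funext h)

end VonNeumannHull

theorem residueField_surjective {A : Type u} [CommRing A] (p : PrimeSpectrum A)
    (z : p.asIdeal.ResidueField) : ∃ x y : A, y ∉ p.asIdeal ∧
      z = algebraMap A p.asIdeal.ResidueField x / algebraMap A p.asIdeal.ResidueField y := by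
  obtain ⟨x, y, hy, rfl⟩ := IsFractionRing.div_surjective (A := A ⧸ p.asIdeal) z
  obtain ⟨x, rfl⟩ := Ideal.Quotient.mk_surjective x
  obtain ⟨y, rfl⟩ := Ideal.Quotient.mk_surjective y
  refine ⟨x, y, fun h => ?_, rfl⟩
  rw [Ideal.Quotient.eq_zero_iff_mem.2 h] at hy
  exact zero_notMem_nonZeroDivisors hy

/-! ### Existence of orders on semi-real rings -/

section Semireal

variable {A : Type u} [CommRing A]

theorem IsSumSq.exists_localization {z : Localization (onePlusSumSq A)} (hz : IsSumSq z) :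
    ∃ s ∈ onePlusSumSq A, ∃ t, IsSumSq t ∧
      z * algebraMap A _ s ^ 2 = algebraMap A (Localization (onePlusSumSq A)) t := by
  induction hz with
  | zero => exact ⟨1, Submonoid.one_mem _, 0, IsSumSq.zero, by simp⟩
  | @sq_add w z _ ih =>
    obtain ⟨s, hs, t, ht, h⟩ := ih
    obtain ⟨⟨x, r⟩, hx⟩ := IsLocalization.surj (onePlusSumSq A) w
    refine ⟨s * r, Submonoid.mul_mem _ hs r.2, (x * s) * (x * s) + r * r * t,
      ((IsSumSq.mul_self (r : A)).mul ht).sq_add _, ?_⟩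
    simp only [map_mul, map_add, ← h]
    simp only at hx
    rw [← hx]
    ring

theorem isUnit_one_add_isSumSq_localization {z : Localization (onePlusSumSq A)}
    (hz : IsSumSq z) : IsUnit (1 + z) := by
  obtain ⟨s, hs, t, ht, h⟩ := hz.exists_localization
  obtain ⟨r, hr, hr'⟩ := Submonoid.mul_mem _ hs hs
  -- After multiplication by `s²`, the element `1 + z` becomes the image of `s² + t`, which is
  -- inverted in the localization.
  have hmem : s * s + t ∈ onePlusSumSq A := ⟨r + t, hr.add ht, by rw [hr', add_assoc]⟩
  refine isUnit_of_mul_isUnit_left (y := algebraMap A _ s ^ 2) ?_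
  have h1 : (1 + z) * algebraMap A (Localization (onePlusSumSq A)) s ^ 2 =
      algebraMap A _ (s * s + t) := by
    rw [map_add, ← h, map_mul]
    ring
  rw [h1]
  exact IsLocalization.map_units _ (⟨_, hmem⟩ : onePlusSumSq A)

/-- Inverting `1 + ∑ A²` leaves a nonzero ring in which every `1 + z`, with `z` a sum of squares, is
a unit. Its residue fields at maximal ideals are therefore semi-real, and an order of one of them
pulls back to `A`. -/
theorem Sper.nonempty_of_semireal (hA : IsSemireal A) : Nonempty (Sper A) := by
  have hnt : Nontrivial (Localization (onePlusSumSq A)) := by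
    rw [← not_subsingleton_iff_nontrivial, IsLocalization.subsingleton_iff (M := onePlusSumSq A)]
    rintro ⟨s, hs, h⟩
    exact hA.one_add_ne_zero hs h.symm
  obtain ⟨m, hm⟩ := Ideal.exists_maximal (Localization (onePlusSumSq A))
  let _ := Ideal.Quotient.field m
  have : IsSemireal (Localization (onePlusSumSq A) ⧸ m) := ⟨fun {w} hw h => by
    obtain ⟨z, hz, rfl⟩ := hw.exists_map_eq _ Ideal.Quotient.mk_surjective
    refine hm.ne_top (m.eq_top_of_isUnit_mem ?_ (isUnit_one_add_isSumSq_localization hz))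
    rw [← Ideal.Quotient.eq_zero_iff_mem]
    simpa using h⟩
  obtain ⟨σ⟩ := Sper.nonempty_of_isSemireal (K := Localization (onePlusSumSq A) ⧸ m)
  exact ⟨σ.compRingHom ((Ideal.Quotient.mk m).comp (algebraMap A _))⟩

end Semireal

/-! ### Orders of `A` and orders of `V(A)` -/

namespace Sper

variable {A : Type u} [CommRing A]

/-- This makes the sign of a fraction `x / y`, taken to be the sign of `xy`, independent of the
representation. -/
theorem mul_eq_mul_of_div_eq (σ : Sper A) {x y x' y' : A} (hy : y ∉ σ.supp.asIdeal)
    (hy' : y' ∉ σ.supp.asIdeal)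
    (h : algebraMap A σ.supp.asIdeal.ResidueField x / algebraMap A _ y =
      algebraMap A σ.supp.asIdeal.ResidueField x' / algebraMap A _ y') :
    σ.toFun (x * y) = σ.toFun (x' * y') := by
  have h0 := mt Ideal.algebraMap_residueField_eq_zero.mp hy
  have h0' := mt Ideal.algebraMap_residueField_eq_zero.mp hy'
  rw [div_eq_div_iff h0 h0', ← map_mul, ← map_mul, ← sub_eq_zero, ← map_sub,
    Ideal.algebraMap_residueField_eq_zero, mem_supp] at h
  have h1 := σ.congr_of_sub_eq_zero h
  rw [mem_supp] at hy hy'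
  rw [σ.map_mul, σ.map_mul] at h1 ⊢
  revert h1 hy hy'
  generalize σ.toFun x = a
  generalize σ.toFun y = b
  generalize σ.toFun x' = c
  generalize σ.toFun y' = d
  revert a b c d
  decide

/-- The sign on the residue field at the support of an order. -/
noncomputable def residueSign (σ : Sper A) (z : σ.supp.asIdeal.ResidueField) : SignType :=
  σ.toFun ((residueField_surjective _ z).choose * (residueField_surjective _ z).choose_spec.choose)

theorem residueSign_div (σ : Sper A) (x : A) {y : A} (hy : y ∉ σ.supp.asIdeal) :
    σ.residueSign (algebraMap A _ x / algebraMap A _ y) = σ.toFun (x * y) := by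
  have h := (residueField_surjective _ (algebraMap A σ.supp.asIdeal.ResidueField x /
    algebraMap A _ y)).choose_spec.choose_spec
  exact σ.mul_eq_mul_of_div_eq h.1 hy h.2.symm

theorem residueSign_algebraMap (σ : Sper A) (x : A) :
    σ.residueSign (algebraMap A _ x) = σ.toFun x := by
  simpa using σ.residueSign_div x σ.supp.isPrime.one_notMem

/-- The order of the residue field at the support of an order. -/
noncomputable def residueField (σ : Sper A) : Sper σ.supp.asIdeal.ResidueField where
  toFun := σ.residueSign
  map_hadd z w w' h := by
    obtain rfl : z = w + w' := h
    obtain ⟨x, y, hy, rfl⟩ := residueField_surjective _ w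
    obtain ⟨x', y', hy', rfl⟩ := residueField_surjective _ w'
    have h0 := mt Ideal.algebraMap_residueField_eq_zero.mp hy
    have h0' := mt Ideal.algebraMap_residueField_eq_zero.mp hy'
    have hyy : y * y' ∉ σ.supp.asIdeal := fun h => (σ.supp.isPrime.mem_or_mem h).elim hy hy'
    rw [div_add_div _ _ h0 h0', ← map_mul, ← map_mul, ← map_add, ← map_mul,
      residueSign_div _ _ hyy, residueSign_div _ _ hy, residueSign_div _ _ hy']
    -- The factors `y'²` and `y²` are squares of elements off the support, so they do not affect
    -- signs.
    have h1 : (x * y' + y * x') * (y * y') = x * y * (y' * y') + x' * y' * (y * y) := by ring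
    have h2 : ∀ a b : A, b ∉ σ.supp.asIdeal → σ.toFun (a * (b * b)) = σ.toFun a := by
      intro a b hb
      rw [mem_supp] at hb
      rw [σ.map_mul, σ.map_mul]
      revert hb
      generalize σ.toFun a = s
      generalize σ.toFun b = t
      revert s t
      decide
    have h3 := σ.map_add_mem (x * y * (y' * y')) (x' * y' * (y * y))
    rwa [h2 _ _ hy, h2 _ _ hy', ← h1] at h3
  map_mul w w' := by
    obtain ⟨x, y, hy, rfl⟩ := residueField_surjective _ w
    obtain ⟨x', y', hy', rfl⟩ := residueField_surjective _ w'
    have hyy : y * y' ∉ σ.supp.asIdeal := fun h => (σ.supp.isPrime.mem_or_mem h).elim hy hy'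
    rw [div_mul_div_comm, ← _root_.map_mul, ← _root_.map_mul, residueSign_div _ _ hyy,
      residueSign_div _ _ hy, residueSign_div _ _ hy', ← σ.map_mul]
    congr 1
    ring
  map_zero := by
    rw [← _root_.map_zero (algebraMap A _), residueSign_algebraMap, σ.map_zero]
  map_one := by
    rw [← _root_.map_one (algebraMap A _), residueSign_algebraMap, σ.map_one]
  map_neg w := by
    obtain ⟨x, y, hy, rfl⟩ := residueField_surjective _ w
    rw [← neg_div, ← _root_.map_neg, residueSign_div _ _ hy, residueSign_div _ _ hy, neg_mul,
      σ.map_neg]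

/-- The extension of an order of `A` to `V(A)`. -/
noncomputable def hull (σ : Sper A) : Sper (VonNeumannHull A) :=
  σ.residueField.compRingHom (VonNeumannHull.eval σ.supp)

theorem hull_ofRing (σ : Sper A) (a : A) :
    σ.hull.toFun (VonNeumannHull.ofRing A a) = σ.toFun a :=
  σ.residueSign_algebraMap a

theorem hull_of_eval_eq (σ : Sper A) {f : VonNeumannHull A} {x y : A} (hy : y ∉ σ.supp.asIdeal)
    (h : VonNeumannHull.eval σ.supp f = algebraMap A _ x / algebraMap A _ y) :
    σ.hull.toFun f = σ.toFun (x * y) := by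
  change σ.residueSign (VonNeumannHull.eval σ.supp f) = _
  rw [h, residueSign_div _ _ hy]

theorem map_prod_eq_one (σ : Sper A) {ι : Type v} (s : Finset ι) (f : ι → A)
    (h : ∀ i ∈ s, σ.toFun (f i) = 1) : σ.toFun (∏ i ∈ s, f i) = 1 := by
  classical
  induction s using Finset.induction_on with
  | empty => exact σ.map_one
  | insert i s hi ih =>
    rw [Finset.prod_insert hi, σ.map_mul, h i (Finset.mem_insert_self i s),
      ih fun j hj => h j (Finset.mem_insert_of_mem hj), one_mul]

/-- The restriction of an order of `V(A)` to `A`. -/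
noncomputable def restrict (τ : Sper (VonNeumannHull A)) : Sper A :=
  τ.compRingHom (VonNeumannHull.ofRing A)

/-- An order of `V(A)` sees only the value at the support of its restriction: `f` vanishes on a
whole basic constructible neighbourhood of that prime, so it is annihilated by some `g` supported
there, and `τ` does not vanish at `g`. -/
theorem eq_zero_of_eval_eq_zero (τ : Sper (VonNeumannHull A)) {f : VonNeumannHull A}
    (hf : VonNeumannHull.eval τ.restrict.supp f = 0) : τ.toFun f = 0 := by
  obtain ⟨U, hU, hp, x, y, h⟩ := VonNeumannHull.exists_isOpen_eval f τ.restrict.supp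
  have hx : x ∈ τ.restrict.supp.asIdeal := by
    obtain ⟨hy, hxy⟩ := h _ hp
    rw [hf, eq_comm, div_eq_zero_iff, or_iff_left (mt Ideal.algebraMap_residueField_eq_zero.mp hy),
      Ideal.algebraMap_residueField_eq_zero] at hxy
    exact hxy
  obtain ⟨a, ha, s, hs, hsU⟩ := exists_basic_subset_of_isOpen_constructible hU hp
  choose w hw using fun b : A => VonNeumannHull.isVonNeumannRegular A (VonNeumannHull.ofRing A b)
  classical
  -- Each factor `1 - b w(b)` is the indicator of `V(b)`. Inserting `x`, the numerator of `f`, cuts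
  -- the neighbourhood down to where `f` vanishes.
  let g := VonNeumannHull.ofRing A a *
    ∏ b ∈ insert x s, (1 - VonNeumannHull.ofRing A b * w b)
  have hg : τ.toFun g ≠ 0 := by
    rw [τ.map_mul, map_prod_eq_one, mul_one]
    · exact ha
    · intro b hb
      have hb' : τ.toFun (VonNeumannHull.ofRing A b) = 0 :=
        (Finset.mem_insert.1 hb).elim (fun h => h ▸ hx) (hs b)
      rw [sub_eq_add_neg, τ.add_of_eq_zero, τ.map_one]
      rw [τ.map_neg, τ.map_mul, hb', zero_mul, neg_zero]
  have hgf : g * f = 0 := by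
    refine VonNeumannHull.ext_eval fun q => ?_
    rw [map_mul, map_zero, map_mul, map_prod]
    by_cases hq : a ∉ q.asIdeal ∧ ∀ b ∈ insert x s, b ∈ q.asIdeal
    · obtain ⟨-, hfq⟩ := h q (hsU q hq.1 fun b hb => hq.2 b (Finset.mem_insert_of_mem hb))
      rw [hfq, Ideal.algebraMap_residueField_eq_zero.2 (hq.2 x (Finset.mem_insert_self x s)),
        zero_div, mul_zero]
    · obtain haq | ⟨b, hb, hbq⟩ : a ∈ q.asIdeal ∨ ∃ b ∈ insert x s, b ∉ q.asIdeal := by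
        by_contra hc
        push Not at hc
        exact hq hc
      · rw [VonNeumannHull.eval_ofRing, Ideal.algebraMap_residueField_eq_zero.2 haq, zero_mul,
          zero_mul]
      · rw [Finset.prod_eq_zero hb, mul_zero, zero_mul]
        have h0 := mt Ideal.algebraMap_residueField_eq_zero.mp hbq
        have h1 := congrArg (VonNeumannHull.eval q) (hw b)
        rw [map_mul, map_pow, VonNeumannHull.eval_ofRing] at h1
        rw [map_sub, map_one, map_mul, VonNeumannHull.eval_ofRing, sub_eq_zero]
        apply mul_left_cancel₀ h0
        linear_combination h1
  have h2 := τ.map_mul g f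
  rw [hgf, τ.map_zero, eq_comm, mul_eq_zero] at h2
  exact h2.resolve_left hg

theorem hull_restrict (τ : Sper (VonNeumannHull A)) : τ.restrict.hull = τ := by
  ext f
  obtain ⟨x, y, hy, h⟩ := residueField_surjective _ (VonNeumannHull.eval τ.restrict.supp f)
  rw [hull_of_eval_eq _ hy h]
  have h0 := mt Ideal.algebraMap_residueField_eq_zero.mp hy
  -- Thus `τ(x) = τ(f)τ(y)`, and `τ(xy) = τ(f)τ(y)² = τ(f)`.
  have h1 : τ.toFun (f * VonNeumannHull.ofRing A y - VonNeumannHull.ofRing A x) = 0 := by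
    apply τ.eq_zero_of_eval_eq_zero
    rw [map_sub, map_mul, VonNeumannHull.eval_ofRing, VonNeumannHull.eval_ofRing, h]
    rw [div_mul_cancel₀ _ h0, sub_self]
  have h2 := τ.congr_of_sub_eq_zero h1
  change τ.toFun (VonNeumannHull.ofRing A (x * y)) = _
  rw [mem_supp] at hy
  change ¬ τ.toFun (VonNeumannHull.ofRing A y) = 0 at hy
  rw [_root_.map_mul, τ.map_mul, ← h2, τ.map_mul]
  revert hy
  generalize τ.toFun f = a
  generalize τ.toFun (VonNeumannHull.ofRing A y) = b
  revert a b
  decide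

theorem restrict_hull (σ : Sper A) : σ.hull.restrict = σ := by
  ext a
  exact σ.hull_ofRing a

end Sper

/-! ### Complements and the realization of signs from `V(A)` in `A` -/

/-- The zero loci of elements of `A` on the real spectrum are complements of zero loci. -/
def HasComplements (A : Type u) [CommRing A] : Prop :=
  ∀ a : A, ∃ e : A, ∀ σ : Sper A,
    (σ.toFun a = 0 → σ.toFun e = 1) ∧ (σ.toFun a ≠ 0 → σ.toFun e = 0)

theorem VonNeumannHull.exists_local {A : Type u} [CommRing A] (hA : HasComplements A)
    (g h : VonNeumannHull A) (p : PrimeSpectrum A) : ∃ a ∉ p.asIdeal, ∃ s : Finset A,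
      (∀ b ∈ s, b ∈ p.asIdeal) ∧ ∃ e b c : A, ∀ σ : Sper A, (σ.toFun e = 0 ∨ σ.toFun e = 1) ∧
      (a ∉ σ.supp.asIdeal ∧ (∀ b ∈ s, b ∈ σ.supp.asIdeal) → σ.toFun e = 1) ∧
      (σ.toFun e = 1 → σ.hull.toFun g = σ.toFun b ∧ σ.hull.toFun h = σ.toFun c ∧
        σ.hull.toFun (g + h) = σ.toFun (b + c)) := by
  obtain ⟨U, hU, hp, x, y, hg⟩ := exists_isOpen_eval g p
  obtain ⟨U', hU', hp', x', y', hh⟩ := exists_isOpen_eval h p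
  obtain ⟨a, ha, s, hs, hsU⟩ := exists_basic_subset_of_isOpen_constructible
    (@IsOpen.inter _ (constructibleTopology _) _ _ hU hU') ⟨hp, hp'⟩
  choose k hk using hA
  classical
  -- On orders, `a² ∏ k(b)` is the indicator of `D(a) ∩ V(s)`. Over the common denominator `yy'`,
  -- multiplying the numerators of `g` and `h` by `yy'` gives their signs and makes `b + c` carry
  -- the sign of `g + h`.
  refine ⟨a, ha, s, hs, a ^ 2 * ∏ b ∈ s, k b, x * y' * (y * y'), y * x' * (y * y'), fun σ => ?_⟩
  by_cases hσ : a ∉ σ.supp.asIdeal ∧ ∀ b ∈ s, b ∈ σ.supp.asIdeal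
  · have h1 : σ.toFun (a ^ 2 * ∏ b ∈ s, k b) = 1 := by
      rw [σ.map_mul, σ.map_prod_eq_one _ _ fun b hb => (hk b σ).1 (hσ.2 b hb), mul_one, σ.map_sq]
      have h2 := hσ.1
      rw [Sper.mem_supp] at h2
      revert h2
      generalize σ.toFun a = t
      revert t
      decide
    refine ⟨Or.inr h1, fun _ => h1, fun _ => ?_⟩
    obtain ⟨h2, h3⟩ := hsU _ hσ.1 hσ.2
    obtain ⟨hy, hg⟩ := hg _ h2
    obtain ⟨hy', hh⟩ := hh _ h3
    have hyy : y * y' ∉ σ.supp.asIdeal := fun h => (σ.supp.isPrime.mem_or_mem h).elim hy hy'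
    have h0 := mt Ideal.algebraMap_residueField_eq_zero.mp hy
    have h0' := mt Ideal.algebraMap_residueField_eq_zero.mp hy'
    refine ⟨σ.hull_of_eval_eq hyy ?_, σ.hull_of_eval_eq hyy ?_, ?_⟩
    · rw [hg, map_mul, map_mul]
      field_simp
    · rw [hh, map_mul, map_mul]
      field_simp
    · rw [← add_mul]
      refine σ.hull_of_eval_eq hyy ?_
      rw [map_add, hg, hh, map_add, map_mul, map_mul, map_mul, div_add_div _ _ h0 h0']
  · have h1 : σ.toFun (a ^ 2 * ∏ b ∈ s, k b) = 0 := by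
      obtain haσ | ⟨b, hb, hbσ⟩ : a ∈ σ.supp.asIdeal ∨ ∃ b ∈ s, b ∉ σ.supp.asIdeal := by
        by_contra hc
        push Not at hc
        exact hσ hc
      · rw [σ.map_mul, σ.map_sq, Sper.mem_supp.1 haσ]
        simp
      · rw [← Finset.mul_prod_erase _ _ hb, σ.map_mul, σ.map_mul, (hk b σ).2 hbσ]
        simp
    refine ⟨Or.inl h1, fun h => absurd h hσ, fun h => ?_⟩
    rw [h1] at h
    exact absurd h (by decide)

/-- The pair is found jointly with its sum because reflecting the multivalued sum of `Q(V(A))` needs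
representatives `b`, `c` and `b + c` at once. -/
theorem VonNeumannHull.exists_sign_eq {A : Type u} [CommRing A] (hA : HasComplements A)
    (g h : VonNeumannHull A) : ∃ b c : A, ∀ σ : Sper A, σ.hull.toFun g = σ.toFun b ∧
      σ.hull.toFun h = σ.toFun c ∧ σ.hull.toFun (g + h) = σ.toFun (b + c) := by
  have key := @IsCompact.induction_on _ (constructibleTopology (PrimeSpectrum A)) _
    isCompact_univ_constructible
    (fun W => ∃ e b c : A, ∀ σ : Sper A, (σ.toFun e = 0 ∨ σ.toFun e = 1) ∧
      (σ.supp ∈ W → σ.toFun e = 1) ∧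
      (σ.toFun e = 1 → σ.hull.toFun g = σ.toFun b ∧ σ.hull.toFun h = σ.toFun c ∧
        σ.hull.toFun (g + h) = σ.toFun (b + c)))
    ⟨0, 0, 0, fun σ => ⟨Or.inl σ.map_zero, fun h => h.elim, fun h => by
      rw [σ.map_zero] at h
      exact absurd h (by decide)⟩⟩
    (fun W W' hW ⟨e, b, c, h⟩ => ⟨e, b, c, fun σ => ⟨(h σ).1, fun hσ => (h σ).2.1 (hW hσ),
      (h σ).2.2⟩⟩)
    ?_ ?_
  · obtain ⟨e, b, c, h⟩ := key
    exact ⟨b, c, fun σ => (h σ).2.2 ((h σ).2.1 trivial)⟩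
  · rintro W W' ⟨e, b, c, hW⟩ ⟨e', b', c', hW'⟩
    obtain ⟨k, hk⟩ := hA e
    -- The indicator `k` of `e = 0` makes the two pieces disjoint: at each order at most one summand
    -- is nonzero, so signs of sums are determined.
    refine ⟨e + e' * k, e * b + e' * k * b', e * c + e' * k * c', fun σ => ?_⟩
    obtain ⟨h1, h2, h3⟩ := hW σ
    obtain ⟨h1', h2', h3'⟩ := hW' σ
    obtain h0 | h0 := h1
    · have hmul : ∀ z, σ.toFun (e * z) = 0 := fun z => by rw [σ.map_mul, h0, zero_mul]
      have hk1 : σ.toFun (e' * k) = σ.toFun e' := by rw [σ.map_mul, (hk σ).1 h0, mul_one]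
      have he : σ.toFun (e + e' * k) = σ.toFun e' := by rw [σ.zero_add_of_eq_zero _ h0, hk1]
      rw [he]
      refine ⟨h1', fun hσ => hσ.elim (fun hσ => ?_) h2', fun hσ => ?_⟩
      · rw [h2 hσ] at h0
        exact absurd h0 (by decide)
      · have hz : ∀ z z', σ.toFun (e * z + e' * k * z') = σ.toFun z' := fun z z' => by
          rw [σ.zero_add_of_eq_zero _ (hmul z), σ.map_mul, hk1, hσ, one_mul]
        have hadd : e * b + e' * k * b' + (e * c + e' * k * c') =
          e * (b + c) + e' * k * (b' + c') := by ring
        rw [hadd, hz, hz, hz]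
        exact h3' hσ
    · have hmul : ∀ z, σ.toFun (e' * k * z) = 0 := fun z => by
        rw [σ.map_mul, σ.map_mul, (hk σ).2 (by rw [h0]; decide), mul_zero, zero_mul]
      have he : σ.toFun (e + e' * k) = 1 := by
        rw [σ.add_of_eq_zero _ (by simpa using hmul 1), h0]
      have hz : ∀ z z', σ.toFun (e * z + e' * k * z') = σ.toFun z := fun z z' => by
        rw [σ.add_of_eq_zero _ (hmul z'), σ.map_mul, h0, one_mul]
      have hadd : e * b + e' * k * b' + (e * c + e' * k * c') =
        e * (b + c) + e' * k * (b' + c') := by ring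
      refine ⟨Or.inr he, fun _ => he, fun _ => ?_⟩
      rw [hadd, hz, hz, hz]
      exact h3 h0
  · intro p _
    obtain ⟨a, ha, s, hs, e, b, c, h⟩ := exists_local hA g h p
    refine ⟨{q | a ∉ q.asIdeal} ∩ ⋂ b ∈ s, {q | b ∈ q.asIdeal}, ?_, e, b, c, fun σ =>
      ⟨(h σ).1, fun hσ => (h σ).2.1 ⟨hσ.1, by simpa using hσ.2⟩, (h σ).2.2⟩⟩
    have hmem : p ∈ {q : PrimeSpectrum A | a ∉ q.asIdeal} ∩ ⋂ b ∈ s, {q | b ∈ q.asIdeal} :=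
      ⟨ha, by simpa using hs⟩
    have ho : IsOpen[constructibleTopology (PrimeSpectrum A)]
        ({q | a ∉ q.asIdeal} ∩ ⋂ b ∈ s, {q | b ∈ q.asIdeal}) :=
      @IsOpen.inter _ (constructibleTopology (PrimeSpectrum A)) _ _
        (isOpen_constructible_basicOpen a)
        (@isOpen_biInter_finset _ _ (constructibleTopology (PrimeSpectrum A)) _ _
          fun b _ => isOpen_constructible_zeroLocus b)
    exact @mem_nhdsWithin_of_mem_nhds _ (constructibleTopology (PrimeSpectrum A)) _ _ _
      (@IsOpen.mem_nhds _ (constructibleTopology (PrimeSpectrum A)) _ _ ho hmem)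

/-! ### The two quotients, and complements from a representation -/

namespace RealReduction

variable {A : Type u} [CommRing A]

theorem mk_eq_iff {a b : A} : mk a = mk b ↔ ∀ σ : Sper A, σ.toFun a = σ.toFun b :=
  ⟨fun h σ => congrFun (congrArg Subtype.val h) σ, fun h => Subtype.ext (funext h)⟩

theorem mk_surjective (x : RealReduction A) : ∃ a : A, mk a = x :=
  x.2.imp fun _ h => Subtype.ext h

theorem mk_mul (a b : A) : (mk (a * b) : RealReduction A) = mk a * mk b :=
  Subtype.ext (funext fun σ => σ.map_mul a b)

theorem mk_neg (a : A) : (mk (-a) : RealReduction A) = -mk a :=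
  Subtype.ext (funext fun σ => σ.map_neg a)

end RealReduction

namespace MarshallQuotient

variable {B : Type u} [CommRing B] {S : Submonoid B}

theorem mk_eq_iff {a b : B} : mk S a = mk S b ↔ ∃ s ∈ S, ∃ t ∈ S, a * s = b * t :=
  Quotient.eq (r := marshallSetoid S)

theorem mk_surjective (x : MarshallQuotient S) : ∃ b : B, mk S b = x := Quotient.exists_rep x

theorem mk_mul (a b : B) : mk S (a * b) = mk S a * mk S b := rfl

theorem mk_mul_of_mem (a : B) {s : B} (hs : s ∈ S) : mk S (a * s) = mk S a :=
  mk_eq_iff.2 ⟨1, S.one_mem, s, hs, mul_one _⟩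

end MarshallQuotient

theorem hasComplements_of_marshallQuotient {A : Type u} [CommRing A] {B : Type v} [CommRing B]
    {S : Submonoid B} (φ : MultiringEquiv (RealReduction A) (MarshallQuotient S)) :
    HasComplements A := by
  intro a
  obtain ⟨b, hb⟩ := MarshallQuotient.mk_surjective (φ.toFun (RealReduction.mk a))
  have hcube : RealReduction.mk (a * a * a) = RealReduction.mk a := by
    refine RealReduction.mk_eq_iff.2 fun σ => ?_
    rw [σ.map_mul, σ.map_mul]
    generalize σ.toFun a = x
    revert x
    decide
  have hcube' : MarshallQuotient.mk S (b * b * b) = MarshallQuotient.mk S b := by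
    rw [MarshallQuotient.mk_mul, MarshallQuotient.mk_mul, hb, ← φ.map_mul, ← φ.map_mul,
      ← RealReduction.mk_mul, ← RealReduction.mk_mul, hcube]
  obtain ⟨s, hs, t, ht, h⟩ := MarshallQuotient.mk_eq_iff.1 hcube'
  -- As `s, t ∈ S`, this difference represents an element of `â² - 1`, and `b³s = bt` makes it
  -- annihilate `b`. So `e` has sign `-1` where `a` vanishes and `0` elsewhere.
  obtain ⟨z, hz⟩ := φ.surjective (MarshallQuotient.mk S (b * b * s - t))
  obtain ⟨e, rfl⟩ := RealReduction.mk_surjective z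
  change φ.toFun (RealReduction.mk e) = _ at hz
  have hadd : RealReduction.mk e ∈
      HyperAdd.hadd (RealReduction.mk (a * a)) (RealReduction.mk (-1 : A)) := by
    rw [φ.map_hadd, hz]
    refine ⟨b * b * s - t, b * b * s, -t, rfl, ?_, ?_, sub_eq_add_neg _ _⟩
    · rw [MarshallQuotient.mk_mul_of_mem _ hs, RealReduction.mk_mul, φ.map_mul, ← hb]
      rfl
    · have h1 : -t = -1 * t := by ring
      rw [h1, MarshallQuotient.mk_mul_of_mem _ ht, RealReduction.mk_neg, φ.map_neg]
      change _ = -φ.toFun 1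
      rw [φ.map_one]
      rfl
  have hmul : RealReduction.mk (a * e) = RealReduction.mk 0 := by
    apply φ.injective
    change φ.toFun _ = φ.toFun 0
    rw [RealReduction.mk_mul, φ.map_mul, hz, ← hb, φ.map_zero, ← MarshallQuotient.mk_mul]
    have h1 : b * (b * b * s - t) = 0 := by linear_combination h
    rw [h1]
    rfl
  refine ⟨-e, fun σ => ?_⟩
  rw [RealReduction.mk_eq_iff] at hmul
  obtain ⟨e', c, d, he, hc, hd, rfl⟩ := hadd
  rw [RealReduction.mk_eq_iff] at he hc hd
  have h1 := SignType.mem_hyperSum.1 (σ.map_add_mem c d)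
  have h2 := hmul σ
  rw [he, hc, hd, σ.map_neg, σ.map_one, σ.map_mul] at h1
  rw [σ.map_mul, σ.map_zero] at h2
  rw [σ.map_neg]
  revert h1 h2
  generalize σ.toFun a = x
  generalize σ.toFun e = y
  revert x y
  decide

/-! ### The canonical isomorphisms -/

namespace MultiringEquiv

/-- Composition of isomorphisms of multirings. -/
def comp {M : Type*} {N : Type*} {P : Type*}
    [HyperAdd M] [Mul M] [Neg M] [Zero M] [One M]
    [HyperAdd N] [Mul N] [Neg N] [Zero N] [One N]
    [HyperAdd P] [Mul P] [Neg P] [Zero P] [One P]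
    (e : MultiringEquiv M N) (e' : MultiringEquiv N P) : MultiringEquiv M P where
  toEquiv := e.toEquiv.trans e'.toEquiv
  map_hadd a b c := (e.map_hadd a b c).trans (e'.map_hadd _ _ _)
  map_mul a b := (congrArg e'.toFun (e.map_mul a b)).trans (e'.map_mul _ _)
  map_zero := (congrArg e'.toFun e.map_zero).trans e'.map_zero
  map_one := (congrArg e'.toFun e.map_one).trans e'.map_one
  map_neg a := (congrArg e'.toFun (e.map_neg a)).trans (e'.map_neg _)

end MultiringEquiv

/-- Both quotients define their sums through representatives in `R`, so once they identify the same
elements they are isomorphic. -/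
theorem IsVonNeumannRegular.mk_eq_mk_iff {R : Type u} [CommRing R] (hR : IsVonNeumannRegular R)
    {f g : R} : RealReduction.mk f = RealReduction.mk g ↔
      MarshallQuotient.mk (onePlusSumSq R) f = MarshallQuotient.mk (onePlusSumSq R) g := by
  rw [RealReduction.mk_eq_iff, MarshallQuotient.mk_eq_iff]
  constructor
  · intro h
    obtain ⟨s, t, hs, ht, hst⟩ := hR.exists_onePlusSumSq_mul_eq h
    exact ⟨_, ⟨s, hs, rfl⟩, _, ⟨t, ht, rfl⟩, hst⟩
  · rintro ⟨_, ⟨s, hs, rfl⟩, _, ⟨t, ht, rfl⟩, hst⟩ σ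
    have h := congrArg σ.toFun hst
    rwa [σ.map_mul, σ.map_mul, σ.one_add_isSumSq hs, σ.one_add_isSumSq ht, mul_one, mul_one] at h

/-- A von Neumann regular ring represents its real reduced multiring. -/
noncomputable def IsVonNeumannRegular.realReductionEquiv {R : Type u} [CommRing R]
    (hR : IsVonNeumannRegular R) :
    MultiringEquiv (RealReduction R) (MarshallQuotient (onePlusSumSq R)) :=
  have key : ∀ f : R, MarshallQuotient.mk (onePlusSumSq R)
      (RealReduction.mk_surjective (RealReduction.mk f)).choose =
        MarshallQuotient.mk (onePlusSumSq R) f := fun f =>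
    hR.mk_eq_mk_iff.1 (RealReduction.mk_surjective (RealReduction.mk f)).choose_spec
  { toFun := fun x => MarshallQuotient.mk _ (RealReduction.mk_surjective x).choose
    invFun := Quotient.lift RealReduction.mk fun _ _ h => hR.mk_eq_mk_iff.2 (Quotient.sound h)
    left_inv := fun x => (RealReduction.mk_surjective x).choose_spec
    right_inv := fun y => by
      obtain ⟨f, rfl⟩ := MarshallQuotient.mk_surjective y
      exact key f
    map_hadd := fun x y z => by
      obtain ⟨f, rfl⟩ := RealReduction.mk_surjective x
      obtain ⟨g, rfl⟩ := RealReduction.mk_surjective y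
      obtain ⟨h, rfl⟩ := RealReduction.mk_surjective z
      change (∃ a b c, _) ↔ _ ∈ HyperAdd.hadd (MarshallQuotient.mk _ _) (MarshallQuotient.mk _ _)
      rw [key f, key g, key h]
      simp only [hR.mk_eq_mk_iff]
      rfl
    map_mul := fun x y => by
      obtain ⟨f, rfl⟩ := RealReduction.mk_surjective x
      obtain ⟨g, rfl⟩ := RealReduction.mk_surjective y
      rw [← RealReduction.mk_mul, key, key, key, MarshallQuotient.mk_mul]
    map_zero := key 0
    map_one := key 1
    map_neg := fun x => by
      obtain ⟨f, rfl⟩ := RealReduction.mk_surjective x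
      rw [← RealReduction.mk_neg, key, key]
      rfl }

theorem IsVonNeumannRegular.realReductionEquiv_mk {R : Type u} [CommRing R]
    (hR : IsVonNeumannRegular R) (f : R) :
    hR.realReductionEquiv.toFun (RealReduction.mk f) = MarshallQuotient.mk (onePlusSumSq R) f :=
  hR.mk_eq_mk_iff.1 (RealReduction.mk_surjective (RealReduction.mk f)).choose_spec

namespace HasComplements

variable {A : Type u} [CommRing A]

/-- The canonical isomorphism `Q(A) ≅ Q(V(A))`. -/
noncomputable def hullEquiv (hA : HasComplements A) :
    MultiringEquiv (RealReduction A) (RealReduction (VonNeumannHull A)) where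
  toFun x := ⟨fun τ => x.1 τ.restrict, by
    obtain ⟨a, rfl⟩ := RealReduction.mk_surjective x
    exact ⟨VonNeumannHull.ofRing A a, rfl⟩⟩
  invFun y := ⟨fun σ => y.1 σ.hull, by
    obtain ⟨f, rfl⟩ := RealReduction.mk_surjective y
    -- Only the sign of `f` is needed; `0` fills the second slot.
    obtain ⟨b, c, h⟩ := VonNeumannHull.exists_sign_eq hA f 0
    exact ⟨b, funext fun σ => (h σ).1.symm⟩⟩
  left_inv x := Subtype.ext (funext fun σ => congrArg x.1 σ.restrict_hull)
  right_inv y := Subtype.ext (funext fun τ => congrArg y.1 τ.hull_restrict)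
  map_hadd x y z := by
    constructor
    · rintro ⟨_, b, c, rfl, rfl, rfl, rfl⟩
      exact ⟨_, VonNeumannHull.ofRing A b, VonNeumannHull.ofRing A c, rfl, rfl, rfl,
        map_add (VonNeumannHull.ofRing A) b c⟩
    · rintro ⟨_, g, h, hx, hy, hz, rfl⟩
      obtain ⟨b, c, hbc⟩ := VonNeumannHull.exists_sign_eq hA g h
      have key : ∀ (f : VonNeumannHull A) (w : RealReduction A),
          (RealReduction.mk f).1 = (fun τ => w.1 τ.restrict) →
          ∀ σ : Sper A, σ.hull.toFun f = w.1 σ := fun f w hw σ =>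
        (congrFun hw σ.hull).trans (congrArg w.1 σ.restrict_hull)
      refine ⟨b + c, b, c, Subtype.ext (funext fun σ => ?_), Subtype.ext (funext fun σ => ?_),
        Subtype.ext (funext fun σ => ?_), rfl⟩
      · exact (hbc σ).2.2.symm.trans (key _ x (congrArg Subtype.val hx) σ)
      · exact (hbc σ).1.symm.trans (key _ y (congrArg Subtype.val hy) σ)
      · exact (hbc σ).2.1.symm.trans (key _ z (congrArg Subtype.val hz) σ)
  map_mul _ _ := rfl
  map_zero := congrArg RealReduction.mk (map_zero (VonNeumannHull.ofRing A))
  map_one := congrArg RealReduction.mk (map_one (VonNeumannHull.ofRing A))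
  map_neg _ := rfl

theorem hullEquiv_mk (hA : HasComplements A) (a : A) :
    hA.hullEquiv.toFun (RealReduction.mk a) = RealReduction.mk (toVonNeumannHull a) := rfl

end HasComplements

theorem mainTheorem10 {A : Type u} [CommRing A] (hA : IsSemireal A)
    {B : Type v} [CommRing B] (S : Submonoid B)
    (hQ : Nonempty (MultiringEquiv (RealReduction A) (MarshallQuotient S))) :
    IsVonNeumannRegular (VonNeumannHull A) ∧
    IsSemireal (VonNeumannHull A) ∧
    (∃ e : MultiringEquiv (RealReduction A) (MarshallQuotient (onePlusSumSq (VonNeumannHull A))),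
      ∀ a : A, e.toFun (RealReduction.mk a) =
        MarshallQuotient.mk (onePlusSumSq (VonNeumannHull A)) (toVonNeumannHull a)) ∧
    (∃ e : MultiringEquiv (RealReduction A) (RealReduction (VonNeumannHull A)),
      ∀ a : A, e.toFun (RealReduction.mk a) = RealReduction.mk (toVonNeumannHull a)) := by
  obtain ⟨φ⟩ := hQ
  have hc := hasComplements_of_marshallQuotient φ
  have hV := VonNeumannHull.isVonNeumannRegular A
  obtain ⟨σ⟩ := Sper.nonempty_of_semireal hA
  -- An order of `A` extends to `V(A)`, and a ring with an order is semi-real.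
  exact ⟨hV, σ.hull.isSemireal_of_sper,
    ⟨hc.hullEquiv.comp hV.realReductionEquiv, fun a => hV.realReductionEquiv_mk _⟩,
    ⟨hc.hullEquiv, hc.hullEquiv_mk⟩⟩
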